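/- For $n\ge 1$ let $\Delta_n$ be the abstract simplicial complex whose simplices are the sets of prime factors of the squarefree integers $1\le k\le n$ (the empty simplex, coming from $k=1$, is included). Let $\widetilde\chi(\Delta_n)=\sum_{\sigma\in\Delta_n}(-1)^{\#\sigma-1}$ be its reduced Euler characteristic, let $d_n=\dim\Delta_n=\max_{\sigma\in\Delta_n}\#\sigma-1$ be its dimension, and let $f^{\Delta_n}_{i}$ be the number of its $i$-simplices, that is, of simplices with $i+1$ vertices. For $0\le i\le d$ let $f_{i,d}$ be the number of chains $\emptyset\ne\sigma_0\subsetneq\sigma_1\subsetneq\cdots\subsetneq\sigma_i=\sigma$ of subsets of a fixed set $\sigma$ with $d+1$ elements. Put $F_{d,d}=1$ for $d\ge 0$, $F_{-1,d}=0$ for $d\ge0$, and, for $0\le i<d$, $$F_{i,d}=\sum_{\substack{\ell\ge 0\\ i=i_0<i_1<\cdots<i_\ell<i_{\ell+1}=d}}\ \prod_{m=0}^{\ell}\frac{f_{i_m,i_{m+1}}}{(d+1)!-(i_m+1)!}.$$ Let $F_d(z)=\sum_{i=-1}^{d}F_{i,d}z^{d-i}$ and $H_d(z)=F_d(z-1)=\sum_{i=0}^{d+1}H_{i,d}z^{d+1-i}$;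 in particular $H_{1,d}$ is the coefficient of $z^{d}$ in $H_d(z)$. For $n\ge 6$ put $$\alpha_n=\frac{\widetilde\chi(\Delta_n)}{H_{1,d_n}\,f^{\Delta_n}_{d_n}}.$$ Then $\widetilde\chi(\Delta_n)=-M(n)=-\sum_{k\le n}\mu(k)$ for all $n\ge 1$, where $\mu$ is the Möbius function. Moreover, if $\alpha_n=O\big((d_n+1)!^{2}\big)$ as $n\to\infty$, then there is a constant $A>0$ such that $$\widetilde\chi(\Delta_n)=O\left(n\exp\left(-A\,\frac{\log n\,\log\log\log n}{\log\log n}\right)\right)\qquad(n\to\infty).$$ -/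

import Mathlib

open Filter Asymptotics
open scoped Nat

/-- A finite abstract simplicial complex: a finite family of finite sets that is closed under
taking subsets. The empty simplex is allowed as a member. -/
structure FinComplex (V : Type*) where
  faces : Finset (Finset V)
  down_closed : ∀ σ ∈ faces, ∀ τ ⊆ σ, τ ∈ faces

namespace FinComplex

variable {V : Type*}

/-- The dimension: one less than the largest number of vertices of a simplex. (A natural number;
the dimension `-1` of the complex whose only simplex is empty is truncated to `0`.) -/
def dim (Δ : FinComplex V) : ℕ := Δ.faces.sup Finset.card - 1

/-- The number of `i`-simplices, i.e. of simplices with `i + 1` vertices. -/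
def numSimplices (Δ : FinComplex V) (i : ℕ) : ℕ := (Δ.faces.filter fun σ => σ.card = i + 1).card

/-- The reduced Euler characteristic, the sum of `(-1) ^ (#σ - 1)` over all simplices `σ`,
the empty one included. The exponent is written `#σ + 1`, which has the same parity. -/
def eulerChar (Δ : FinComplex V) : ℤ := ∑ σ ∈ Δ.faces, (-1) ^ (σ.card + 1)

end FinComplex

/-- The complex of the sets of prime factors of the squarefree integers `1 ≤ k ≤ n`. -/
def primeComplex (n : ℕ) : FinComplex ℕ where
  faces := ((Finset.Icc 1 n).filter Squarefree).image Nat.primeFactors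
  down_closed := by
    intro σ hσ τ hτ
    simp only [Finset.mem_image, Finset.mem_filter, Finset.mem_Icc] at hσ ⊢
    obtain ⟨k, ⟨⟨hk1, hkn⟩, hk⟩, rfl⟩ := hσ
    have hp : ∀ p ∈ τ, p.Prime := fun p h => Nat.prime_of_mem_primeFactors (hτ h)
    have hdvd : ∏ p ∈ τ, p ∣ k := by
      conv_rhs => rw [← Nat.prod_primeFactors_of_squarefree hk]
      exact Finset.prod_dvd_prod_of_subset _ _ _ hτ
    exact ⟨∏ p ∈ τ, p, ⟨⟨Finset.prod_pos fun p h => (hp p h).pos,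
      (Nat.le_of_dvd hk1 hdvd).trans hkn⟩, hk.squarefree_of_dvd hdvd⟩, Nat.primeFactors_prod hp⟩

/-- `f_{i,d}`: the number of simplices `{σ₀ ⊊ σ₁ ⊊ ⋯ ⊊ σᵢ}` of the barycentric subdivision, with
`σ₀` nonempty, whose largest member `σᵢ` is a given `d`-simplex. -/
noncomputable def chainCount (i d : ℕ) : ℕ :=
  Nat.card {σ : Fin (i + 1) → Finset (Fin (d + 1)) //
    StrictMono σ ∧ (σ 0).Nonempty ∧ σ (Fin.last i) = Finset.univ}

/-- The least member of `s` that is larger than `a` (only used where there is one). -/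
def nextIn (s : Finset ℕ) (a : ℕ) : ℕ := (s.filter (a < ·)).min.untopD 0

/-- The numbers `F_{i,d}` for `0 ≤ i ≤ d`: `F_{d,d} = 1` and, for `i < d`, the sum over all chains
`i = i₀ < i₁ < ⋯ < i_ℓ < i_{ℓ+1} = d`, `ℓ ≥ 0`, of the product over `0 ≤ m ≤ ℓ` of
`f_{i_m, i_{m+1}} / ((d + 1)! - (i_m + 1)!)`.
The set `s` below is `{i₁, …, i_ℓ}`. -/
noncomputable def eigenCoeff (i d : ℕ) : ℚ :=
  if i = d then 1
  else ∑ s ∈ (Finset.Ioo i d).powerset, ∏ a ∈ insert i s,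
    (chainCount a (nextIn (insert d s) a) : ℚ) / (((d + 1)! : ℚ) - ((a + 1)! : ℚ))

/-- The `F`-polynomial, the sum over `-1 ≤ i ≤ d` of `F_{i,d} z ^ (d - i)`.
The term `i = -1` is absent because `F_{-1,d} = 0` for `d ≥ 0`. -/
noncomputable def fPoly (d : ℕ) : Polynomial ℚ :=
  ∑ i ∈ Finset.range (d + 1), Polynomial.C (eigenCoeff i d) * Polynomial.X ^ (d - i)

/-- The `H`-polynomial `H_d(z) = F_d(z - 1)`. -/
noncomputable def hPoly (d : ℕ) : Polynomial ℚ := (fPoly d).comp (Polynomial.X - 1)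

/-- The numbers `H_{i,d}`, `0 ≤ i ≤ d + 1`: the coefficient of `z ^ (d + 1 - i)` in `H_d(z)`. -/
noncomputable def hCoeff (i d : ℕ) : ℚ := (hPoly d).coeff (d + 1 - i)

/-- `d_n`, the dimension of the `n`-th complex. -/
def primeDim (n : ℕ) : ℕ := (primeComplex n).dim

/-- `α_n`: the reduced Euler characteristic divided by the product of `H_{1,d_n}` and the number
of `d_n`-simplices. -/
noncomputable def alpha (n : ℕ) : ℚ :=
  ((primeComplex n).eulerChar : ℚ) /
    (hCoeff 1 (primeDim n) * ((primeComplex n).numSimplices (primeDim n) : ℚ))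

/-! The first claim holds because squarefree `k` correspond to faces, with sign `-μ(k)`. For the
second, write `χ = α · H · f` and bound each factor, with `r = d + 1`.

In `F_d(z - 1)` only `i = 0` reaches degree `d`, so `H_{1,d} = F_{0,d}` (`hCoeff_one`). Splitting
off the first link of a chain gives a recursion, and `f_{0,j} = 1` then yields `F_{0,d} ≤ 2 · 4 ^ d
/ (d + 1)!` (`eigenCoeff_zero_le`). This cancels one of the two factorials allowed to `α`.

If `n` lies between the primorials of `y` and of the next prime `y + 1`, then `r = π(y)`, and
Rankin's trick shows that there are at most `exp(O(y / log y))` top simplices (`card_faces_le`,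
`numSimplices_primeDim_le`).

Hence `χ` is at most `r!` up to `exp(O(y / log y))`. Now `r log y = θ(y) + O(y / log y)`, while `log
r ≤ log y - log log y + O(1)`. So `r!` falls short of the primorial, hence of `n`, by a factor
`exp(-c y log log y / log y)` (`exists_factorial_mul_le_primorial`). As `log n` has order `y`, this
is the claimed saving. -/

/-! ### Counting chains of subsets -/

/-- A point lies in the `m`-th member of an increasing family of finite sets if and only if it is
missing from at most `m` members. -/
theorem mem_iff_card_filter_notMem_le {α : Type*} [DecidableEq α] {k : ℕ}
    {σ : Fin k → Finset α} (hσ : Monotone σ) (x : α) (m : Fin k) :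
    x ∈ σ m ↔ (Finset.univ.filter fun l => x ∉ σ l).card ≤ m := by
  constructor
  · intro hx
    calc (Finset.univ.filter fun l => x ∉ σ l).card ≤ (Finset.Iio m).card := by
          refine Finset.card_le_card fun l hl => ?_
          simp only [Finset.mem_filter, Finset.mem_univ, true_and] at hl
          rw [Finset.mem_Iio]
          by_contra! h
          exact hl (hσ h hx)
      _ = m := Fin.card_Iio m
  · intro h
    by_contra hx
    have : (Finset.Iic m).card ≤ (Finset.univ.filter fun l => x ∉ σ l).card := by
      refine Finset.card_le_card fun l hl => ?_
      simp only [Finset.mem_filter, Finset.mem_univ, true_and]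
      exact fun hl' => hx (hσ (Finset.mem_Iic.1 hl) hl')
    rw [Fin.card_Iic] at this
    omega

/-- An increasing family of finite subsets of `Fin n` consists of the images of initial segments
under the permutation that sorts the points by the index of their first appearance. -/
theorem mem_iff_sort_symm_lt_card {n k : ℕ} {σ : Fin k → Finset (Fin n)} (hσ : Monotone σ)
    (x : Fin n) (m : Fin k) :
    x ∈ σ m ↔ (((Tuple.sort fun x => (Finset.univ.filter fun l => x ∉ σ l).card).symm x : Fin n) :
      ℕ) < (σ m).card := by
  set g : Fin n → ℕ := fun x => (Finset.univ.filter fun l => x ∉ σ l).card with hg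
  have h := Tuple.lt_card_le_iff_apply_le_of_monotone (f := g ∘ Tuple.sort g) (a := (m : ℕ))
    (j := (Tuple.sort g).symm x) (Tuple.monotone_sort g)
  have hc : (Finset.univ.filter fun i => (g ∘ Tuple.sort g) i ≤ m).card = (σ m).card := by
    refine Finset.card_bij (fun i _ => Tuple.sort g i) ?_ ?_ ?_
    · intro i hi
      rw [mem_iff_card_filter_notMem_le hσ]
      simpa using hi
    · intro i _ j _ hij
      exact (Tuple.sort g).injective hij
    · intro y hy
      rw [mem_iff_card_filter_notMem_le hσ] at hy
      exact ⟨(Tuple.sort g).symm y, by simpa using hy, by simp⟩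
  rw [hc] at h
  rw [h, mem_iff_card_filter_notMem_le hσ]
  simp [hg]

/-- A chain is recovered from a permutation listing the points by first appearance and from the
sizes of its `i` proper members, which form an `i`-subset of `[1, j]`. -/
theorem chainCount_le (i j : ℕ) : chainCount i j ≤ (j + 1)! * j.choose i := by
  classical
  let X := {σ : Fin (i + 1) → Finset (Fin (j + 1)) //
    StrictMono σ ∧ (σ 0).Nonempty ∧ σ (Fin.last i) = Finset.univ}
  let sizes : X → Finset ℕ := fun σ => Finset.univ.image fun m : Fin i => (σ.1 m.castSucc).card
  have hmono : ∀ σ : X, StrictMono fun m : Fin i => (σ.1 m.castSucc).card := fun σ a b hab =>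
    Finset.card_lt_card (σ.2.1 (Fin.castSucc_lt_castSucc_iff.2 hab))
  have hsizes : ∀ σ : X, sizes σ ∈ (Finset.Icc 1 j).powersetCard i := by
    intro σ
    rw [Finset.mem_powersetCard]
    constructor
    · intro a ha
      simp only [sizes, Finset.mem_image, Finset.mem_univ, true_and] at ha
      obtain ⟨m, rfl⟩ := ha
      have h1 : (σ.1 0).card ≤ (σ.1 m.castSucc).card :=
        Finset.card_le_card (σ.2.1.monotone (Fin.zero_le _))
      have h2 : (σ.1 m.castSucc).card < (σ.1 (Fin.last i)).card :=
        Finset.card_lt_card (σ.2.1 (Fin.castSucc_lt_last m))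
      have h3 := σ.2.2.1.card_pos
      rw [σ.2.2.2, Finset.card_univ, Fintype.card_fin] at h2
      rw [Finset.mem_Icc]
      omega
    · rw [Finset.card_image_of_injective _ (hmono σ).injective, Finset.card_univ,
        Fintype.card_fin]
  let Φ : X → Equiv.Perm (Fin (j + 1)) × ((Finset.Icc 1 j).powersetCard i : Finset (Finset ℕ)) :=
    fun σ => (Tuple.sort fun x => (Finset.univ.filter fun l => x ∉ σ.1 l).card,
      ⟨sizes σ, hsizes σ⟩)
  have hinj : Function.Injective Φ := by
    intro σ τ h
    have h1 := congrArg Prod.fst h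
    have h2 : sizes σ = sizes τ := congrArg (fun z => (z.2 : Finset ℕ)) h
    -- The set of sizes determines their sequence, because the sizes strictly increase.
    have h3 : (fun m : Fin i => (σ.1 m.castSucc).card) = fun m : Fin i => (τ.1 m.castSucc).card := by
      rw [← (hmono σ).range_inj (hmono τ)]
      have := congrArg (fun s : Finset ℕ => (s : Set ℕ)) h2
      simpa [sizes] using this
    apply Subtype.ext
    funext m
    refine Fin.lastCases ?_ (fun m => ?_) m
    · rw [σ.2.2.2, τ.2.2.2]
    · ext x
      rw [mem_iff_sort_symm_lt_card σ.2.1.monotone, mem_iff_sort_symm_lt_card τ.2.1.monotone]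
      have h4 := congrFun h3 m
      simp only [Φ] at h1 h4
      rw [h1, h4]
  calc chainCount i j = Nat.card X := rfl
    _ ≤ _ := Nat.card_le_card_of_injective Φ hinj
    _ = (j + 1)! * j.choose i := by
      rw [Nat.card_prod, Nat.card_perm, Nat.card_eq_fintype_card, Fintype.card_fin,
        Nat.card_eq_fintype_card, Fintype.card_coe, Finset.card_powersetCard, Nat.card_Icc,
        Nat.add_sub_cancel]

theorem chainCount_zero_left (d : ℕ) : chainCount 0 d = 1 := by
  rw [chainCount, Nat.card_eq_one_iff_unique]
  have : Subsingleton (Fin (0 + 1)) := Fin.subsingleton_one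
  refine ⟨⟨fun σ τ => ?_⟩, ⟨⟨fun _ => Finset.univ, ?_, ?_, rfl⟩⟩⟩
  · apply Subtype.ext
    funext m
    rw [Subsingleton.elim m (Fin.last 0), σ.2.2.2, τ.2.2.2]
  · exact Subsingleton.strictMono _
  · exact Finset.univ_nonempty

/-! ### Recursion and bounds for the coefficients `F_{i,d}` and `H_{1,d}` -/

theorem nextIn_insert_of_lt {s : Finset ℕ} {a j : ℕ} (h : j ≤ a) :
    nextIn (insert j s) a = nextIn s a := by
  rw [nextIn, nextIn, Finset.filter_insert, if_neg (by omega)]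

theorem nextIn_eq {s : Finset ℕ} {a j : ℕ} (hj : j ∈ s) (haj : a < j)
    (h : ∀ b ∈ s, a < b → j ≤ b) : nextIn s a = j := by
  have : (s.filter (a < ·)).min = (j : WithTop ℕ) := by
    refine le_antisymm (Finset.min_le (by simp [hj, haj])) (Finset.le_min fun b hb => ?_)
    rw [Finset.mem_filter] at hb
    exact WithTop.coe_le_coe.2 (h b hb.1 hb.2)
  rw [nextIn, this]
  rfl

theorem eigenCoeff_self (d : ℕ) : eigenCoeff d d = 1 := if_pos rfl

/-- A sum over all subsets of an open interval, split according to the least element. -/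
theorem sum_powerset_Ioo {M : Type*} [AddCommMonoid M] (i d : ℕ) (f : Finset ℕ → M) :
    ∑ s ∈ (Finset.Ioo i d).powerset, f s =
      f ∅ + ∑ j ∈ Finset.Ioo i d, ∑ s ∈ (Finset.Ioo j d).powerset, f (insert j s) := by
  by_cases h : i + 1 < d
  · induction hk : d - i generalizing i f with
    | zero => omega
    | succ k ih =>
      have h1 : Finset.Ioo i d = insert (i + 1) (Finset.Ioo (i + 1) d) := by
        ext a; simp only [Finset.mem_Ioo, Finset.mem_insert]; omega
      have h2 : i + 1 ∉ Finset.Ioo (i + 1) d := by simp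
      -- Sets containing `i + 1` have it as least element; the others fall under the induction
      -- hypothesis.
      rw [h1, Finset.sum_powerset_insert h2, Finset.sum_insert h2]
      by_cases h3 : i + 1 + 1 < d
      · rw [ih (i + 1) f h3 (by omega)]
        abel
      · have h4 : Finset.Ioo (i + 1) d = ∅ := by ext a; simp; omega
        simp [h4]
  · have h4 : Finset.Ioo i d = ∅ := by ext a; simp; omega
    simp [h4]

/-- Split off the first link `i < j = i₁`. Every denominator involves only `d` and the lower end of
its link, so the remaining product is a term of `F_{j,d}`. -/
theorem eigenCoeff_rec {i d : ℕ} (h : i < d) :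
    eigenCoeff i d = ∑ j ∈ Finset.Ioc i d,
      (chainCount i j : ℚ) / (((d + 1)! : ℚ) - ((i + 1)! : ℚ)) * eigenCoeff j d := by
  have hI : Finset.Ioc i d = insert d (Finset.Ioo i d) := by
    ext a; simp only [Finset.mem_Ioc, Finset.mem_Ioo, Finset.mem_insert]; omega
  rw [hI, Finset.sum_insert (by simp), eigenCoeff_self, mul_one, eigenCoeff, if_neg h.ne,
    sum_powerset_Ioo]
  congr 1
  · have : nextIn {d} i = d := nextIn_eq (by simp) h (by simp)
    simp [this]
  · refine Finset.sum_congr rfl fun j hj => ?_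
    rw [Finset.mem_Ioo] at hj
    rw [eigenCoeff, if_neg hj.2.ne, Finset.mul_sum]
    refine Finset.sum_congr rfl fun s hs => ?_
    rw [Finset.mem_powerset] at hs
    have hmem : ∀ a ∈ s, j < a ∧ a < d := fun a ha => Finset.mem_Ioo.1 (hs ha)
    rw [Finset.prod_insert (by
      simp only [Finset.mem_insert, not_or]
      exact ⟨hj.1.ne, fun hi => absurd (hmem i hi).1 (by omega)⟩)]
    congr 1
    · have : nextIn (insert d (insert j s)) i = j := by
        refine nextIn_eq (by simp) hj.1 fun b hb _ => ?_
        simp only [Finset.mem_insert] at hb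
        rcases hb with rfl | rfl | hb
        · exact hj.2.le
        · exact le_rfl
        · exact (hmem b hb).1.le
      rw [this]
    · refine Finset.prod_congr rfl fun a ha => ?_
      have : j ≤ a := by
        rcases Finset.mem_insert.1 ha with rfl | ha
        · exact le_rfl
        · exact (hmem a ha).1.le
      rw [Finset.insert_comm, nextIn_insert_of_lt this]

theorem factorial_succ_sub_pos {i d : ℕ} (h : i < d) : (0 : ℚ) < (d + 1)! - (i + 1)! := by
  rw [sub_pos]
  exact_mod_cast (Nat.factorial_lt (by omega)).2 (by omega)

theorem half_factorial_le_sub {i d : ℕ} (h : i < d) :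
    ((d + 1)! : ℚ) / 2 ≤ (d + 1)! - (i + 1)! := by
  have h1 : (i + 1)! ≤ d ! := Nat.factorial_le (by omega)
  have h2 : 2 * (i + 1)! ≤ (d + 1)! := by
    rw [Nat.factorial_succ d]
    exact Nat.mul_le_mul (by omega) h1
  have h3 : (2 : ℚ) * (i + 1)! ≤ (d + 1)! := by exact_mod_cast h2
  linarith

theorem eigenCoeff_nonneg {i d : ℕ} (h : i ≤ d) : 0 ≤ eigenCoeff i d := by
  induction hk : d - i using Nat.strong_induction_on generalizing i with
  | _ k ih =>
    rcases h.eq_or_lt with rfl | h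
    · rw [eigenCoeff_self]; exact zero_le_one
    · rw [eigenCoeff_rec h]
      refine Finset.sum_nonneg fun j hj => ?_
      rw [Finset.mem_Ioc] at hj
      have := factorial_succ_sub_pos h
      have := ih (d - j) (by omega) hj.2 rfl
      positivity

/-- Makes `H_{1,d}` nonzero, so that the division defining `α` can be undone. The one-link chain
already contributes a positive term. -/
theorem eigenCoeff_zero_pos (d : ℕ) : 0 < eigenCoeff 0 d := by
  rcases Nat.eq_zero_or_pos d with rfl | h
  · rw [eigenCoeff_self]; exact zero_lt_one
  · rw [eigenCoeff_rec h]
    have hp := factorial_succ_sub_pos h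
    refine Finset.sum_pos' (fun j hj => ?_) ⟨d, by simp; omega, ?_⟩
    · have := eigenCoeff_nonneg (Finset.mem_Ioc.1 hj).2
      positivity
    · rw [eigenCoeff_self, chainCount_zero_left, Nat.cast_one]
      positivity

/-- Downward induction on `i`. The base 3 is chosen because the sum of `3 ^ (d - j)` over `i < j ≤
d` is at most `3 ^ (d - i) / 2`, which absorbs the factor 2 lost in bounding the denominator below
by `(d + 1)! / 2`. -/
theorem eigenCoeff_le {i d : ℕ} (h : i ≤ d) : eigenCoeff i d ≤ 3 ^ (d - i) * d.choose i := by
  induction hk : d - i using Nat.strong_induction_on generalizing i with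
  | _ k ih =>
    subst hk
    rcases h.eq_or_lt with rfl | h
    · simp [eigenCoeff_self]
    have hp := factorial_succ_sub_pos h
    have hterm : ∀ j ∈ Finset.Ioc i d, (chainCount i j : ℚ) * eigenCoeff j d ≤
        (d + 1)! * d.choose i * 3 ^ (d - j) := by
      intro j hj
      rw [Finset.mem_Ioc] at hj
      have h1 : (chainCount i j : ℚ) ≤ (j + 1)! * j.choose i := by exact_mod_cast chainCount_le i j
      have h2 := ih (d - j) (by omega) hj.2 rfl
      have h3 : (j + 1)! * (d - i).choose (j - i) ≤ (d + 1)! := by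
        have h4 : (d - i).choose (j - i) ≤ (d + 1).choose (j + 1) := by
          calc (d - i).choose (j - i) = (d - i).choose (d - j) := by
                rw [← Nat.choose_symm (by omega)]; congr 1; omega
            _ ≤ (d + 1).choose (d - j) := Nat.choose_le_choose _ (by omega)
            _ = (d + 1).choose (j + 1) := by
                rw [← Nat.choose_symm (by omega)]; congr 1; omega
        calc (j + 1)! * (d - i).choose (j - i) ≤ (j + 1)! * (d + 1).choose (j + 1) :=
              Nat.mul_le_mul_left _ h4
          _ ≤ (d + 1).choose (j + 1) * (j + 1)! * (d + 1 - (j + 1))! := by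
              rw [mul_comm]
              exact Nat.le_mul_of_pos_right _ (Nat.factorial_pos _)
          _ = (d + 1)! := Nat.choose_mul_factorial_mul_factorial (by omega)
      have h5 : d.choose j * j.choose i = d.choose i * (d - i).choose (j - i) :=
        Nat.choose_mul hj.1.le
      have h6 : (j + 1)! * j.choose i * d.choose j ≤ (d + 1)! * d.choose i := by
        calc (j + 1)! * j.choose i * d.choose j = (j + 1)! * (d - i).choose (j - i) *
              d.choose i := by
              rw [mul_assoc, mul_comm (j.choose i), h5]; ring
          _ ≤ _ := Nat.mul_le_mul_right _ h3
      have h7 : ((j + 1)! : ℚ) * j.choose i * d.choose j ≤ (d + 1)! * d.choose i := by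
        exact_mod_cast h6
      calc (chainCount i j : ℚ) * eigenCoeff j d
          ≤ ((j + 1)! * j.choose i) * (3 ^ (d - j) * d.choose j) := by
            gcongr
            exact eigenCoeff_nonneg hj.2
        _ = ((j + 1)! * j.choose i * d.choose j) * 3 ^ (d - j) := by ring
        _ ≤ _ := by gcongr
    have hgeom : ∑ j ∈ Finset.Ioc i d, (3 : ℚ) ^ (d - j) ≤ 3 ^ (d - i) / 2 := by
      have : ∑ j ∈ Finset.Ioc i d, (3 : ℚ) ^ (d - j) = ∑ k ∈ Finset.range (d - i), 3 ^ k := by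
        refine Finset.sum_nbij' (fun j => d - j) (fun k => d - k) ?_ ?_ ?_ ?_ ?_ <;>
          simp only [Finset.mem_Ioc, Finset.mem_range] <;> intros <;> first | omega | trivial
      rw [this, geom_sum_eq (by norm_num)]
      norm_num
      linarith
    rw [eigenCoeff_rec h]
    calc ∑ j ∈ Finset.Ioc i d,
          (chainCount i j : ℚ) / (((d + 1)! : ℚ) - ((i + 1)! : ℚ)) * eigenCoeff j d
        = (∑ j ∈ Finset.Ioc i d, (chainCount i j : ℚ) * eigenCoeff j d) /
            (((d + 1)! : ℚ) - ((i + 1)! : ℚ)) := by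
          rw [Finset.sum_div]
          exact Finset.sum_congr rfl fun j _ => by ring
      _ ≤ 3 ^ (d - i) * d.choose i := by
          rw [div_le_iff₀ hp]
          calc ∑ j ∈ Finset.Ioc i d, (chainCount i j : ℚ) * eigenCoeff j d
              ≤ ∑ j ∈ Finset.Ioc i d, ((d + 1)! * d.choose i : ℚ) * 3 ^ (d - j) :=
                Finset.sum_le_sum hterm
            _ ≤ ((d + 1)! * d.choose i) * (3 ^ (d - i) / 2) := by
                rw [← Finset.mul_sum]
                gcongr
            _ = 3 ^ (d - i) * d.choose i * ((d + 1)! / 2) := by ring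
            _ ≤ _ := by
                gcongr
                exact half_factorial_le_sub h

/-- For `i = 0` the chain counts are 1, so the denominator's factorial survives; the binomial
theorem bounds the sum of the `F_{j,d}` by `(1 + 3) ^ d`. -/
theorem eigenCoeff_zero_le (d : ℕ) : eigenCoeff 0 d ≤ 2 * 4 ^ d / (d + 1)! := by
  rcases Nat.eq_zero_or_pos d with rfl | h
  · norm_num [eigenCoeff_self]
  have hp := factorial_succ_sub_pos h
  have hf : (0 : ℚ) < (d + 1)! := by exact_mod_cast Nat.factorial_pos _
  have hsum : ∑ j ∈ Finset.Ioc 0 d, eigenCoeff j d ≤ 4 ^ d := by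
    calc ∑ j ∈ Finset.Ioc 0 d, eigenCoeff j d
        ≤ ∑ j ∈ Finset.range (d + 1), (1 : ℚ) ^ j * 3 ^ (d - j) * d.choose j := by
          refine (Finset.sum_le_sum fun j hj => ?_).trans
            (Finset.sum_le_sum_of_subset_of_nonneg (fun j hj => ?_) fun j _ _ => by positivity)
          · rw [one_pow, one_mul]
            exact eigenCoeff_le (Finset.mem_Ioc.1 hj).2
          · rw [Finset.mem_Ioc] at hj
            rw [Finset.mem_range]
            omega
      _ = 4 ^ d := by rw [← add_pow]; norm_num
  rw [eigenCoeff_rec h]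
  simp only [chainCount_zero_left, Nat.cast_one]
  rw [← Finset.mul_sum, div_mul_eq_mul_div, one_mul, div_le_div_iff₀ hp hf]
  have := half_factorial_le_sub h
  calc (∑ j ∈ Finset.Ioc 0 d, eigenCoeff j d) * ((d + 1)! : ℚ) ≤ 4 ^ d * (d + 1)! := by gcongr
    _ = 2 * 4 ^ d * ((d + 1)! / 2) := by ring
    _ ≤ _ := by gcongr

/-- `(X - 1) ^ (d - i)` is monic of degree `d - i`, hence reaches degree `d` only for `i = 0`. -/
theorem hCoeff_one (d : ℕ) : hCoeff 1 d = eigenCoeff 0 d := by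
  have hmonic : (Polynomial.X - 1 : Polynomial ℚ).Monic := by
    simpa using Polynomial.monic_X_sub_C (1 : ℚ)
  have hdeg : (Polynomial.X - 1 : Polynomial ℚ).natDegree = 1 := by
    simpa using Polynomial.natDegree_X_sub_C (1 : ℚ)
  have hterm : ∀ i ∈ Finset.range (d + 1), ((Polynomial.C (eigenCoeff i d) *
      (Polynomial.X - 1 : Polynomial ℚ) ^ (d - i)).coeff d) =
      if i = 0 then eigenCoeff i d else 0 := by
    intro i hi
    rw [Polynomial.coeff_C_mul]
    have hnd : ((Polynomial.X - 1 : Polynomial ℚ) ^ (d - i)).natDegree = d - i := by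
      rw [hmonic.natDegree_pow, hdeg, mul_one]
    split_ifs with h0
    · subst h0
      have : ((Polynomial.X - 1 : Polynomial ℚ) ^ (d - 0)).coeff d = 1 := by
        have h := (hmonic.pow (d - 0)).coeff_natDegree
        rwa [hnd, Nat.sub_zero] at h
      rw [this, mul_one]
    · rw [Polynomial.coeff_eq_zero_of_natDegree_lt, mul_zero]
      rw [hnd]
      rw [Finset.mem_range] at hi
      omega
  rw [hCoeff, hPoly, fPoly, Nat.add_sub_cancel, Polynomial.sum_comp]
  simp only [Polynomial.mul_comp, Polynomial.C_comp, Polynomial.pow_comp, Polynomial.X_comp]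
  rw [Polynomial.finsetSum_coeff, Finset.sum_congr rfl hterm]
  simp

/-! ### Faces, Euler characteristic and dimension of the prime complex -/

theorem eulerChar_primeComplex (n : ℕ) :
    (primeComplex n).eulerChar = -∑ k ∈ Finset.Icc 1 n, ArithmeticFunction.moebius k := by
  have hinj : Set.InjOn Nat.primeFactors ((Finset.Icc 1 n).filter Squarefree : Finset ℕ) := by
    intro a ha b hb hab
    simp only [Finset.coe_filter, Set.mem_ofPred_eq] at ha hb
    rw [← Nat.prod_primeFactors_of_squarefree ha.2, ← Nat.prod_primeFactors_of_squarefree hb.2, hab]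
  rw [FinComplex.eulerChar, primeComplex, Finset.sum_image hinj, ← Finset.sum_neg_distrib,
    Finset.sum_filter]
  refine Finset.sum_congr rfl fun k _ => ?_
  split_ifs with h
  · rw [ArithmeticFunction.moebius_apply_of_squarefree h,
      ← (ArithmeticFunction.cardDistinctFactors_eq_cardFactors_iff_squarefree h.ne_zero).2 h,
      pow_succ, ArithmeticFunction.cardDistinctFactors_apply, Nat.primeFactors, mul_neg_one]
    rfl
  · rw [ArithmeticFunction.moebius_eq_zero_of_not_squarefree h, neg_zero]

theorem mem_primeComplex_faces {n : ℕ} {σ : Finset ℕ} :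
    σ ∈ (primeComplex n).faces ↔ (∀ p ∈ σ, p.Prime) ∧ ∏ p ∈ σ, p ≤ n := by
  simp only [primeComplex, Finset.mem_image, Finset.mem_filter, Finset.mem_Icc]
  constructor
  · rintro ⟨k, ⟨⟨_, hkn⟩, hk⟩, rfl⟩
    exact ⟨fun p => Nat.prime_of_mem_primeFactors, by
      rwa [Nat.prod_primeFactors_of_squarefree hk]⟩
  · rintro ⟨hp, hn⟩
    refine ⟨∏ p ∈ σ, p, ⟨⟨Finset.prod_pos fun p h => (hp p h).pos, hn⟩, ?_⟩,
      Nat.primeFactors_prod hp⟩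
    exact Finset.squarefree_prod_of_pairwise_isCoprime (fun p hp' q hq hpq =>
      Nat.coprime_iff_isRelPrime.1 ((Nat.coprime_primes (hp p hp') (hp q hq)).2 hpq))
      fun p h => (hp p h).squarefree

/-- Among the sets of at least `π z` primes, the set of the first `π z` primes has the least
product. -/
theorem primorial_le_prod {z : ℕ} {S : Finset ℕ} (hS : ∀ p ∈ S, p.Prime)
    (hcard : (Nat.primesLE z).card ≤ S.card) : primorial z ≤ ∏ p ∈ S, p := by
  set P := Nat.primesLE z with hP
  have hPS : (P \ S).card ≤ (S \ P).card := by
    have h1 := Finset.card_sdiff_add_card_inter P S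
    have h2 := Finset.card_sdiff_add_card_inter S P
    rw [Finset.inter_comm] at h2
    omega
  -- Exchange argument: primes of `P` missing from `S` are below `z + 1`, and at least as many
  -- primes of `S` outside `P` are at least `z + 1`.
  have h1 : ∏ p ∈ P \ S, p ≤ (z + 1) ^ (P \ S).card := by
    refine Finset.prod_le_pow_card _ _ _ fun p hp => ?_
    have := Nat.le_of_mem_primesLE (Finset.mem_sdiff.1 hp).1
    omega
  have h2 : (z + 1) ^ (S \ P).card ≤ ∏ p ∈ S \ P, p := by
    refine Finset.pow_card_le_prod _ _ _ fun p hp => ?_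
    rw [Finset.mem_sdiff, hP, Nat.mem_primesLE] at hp
    by_contra! h
    exact hp.2 ⟨by omega, hS p hp.1⟩
  rw [primorial_eq_prod_primesLE, ← Finset.prod_inter_mul_prod_sdiff P S,
    ← Finset.prod_inter_mul_prod_sdiff S P, Finset.inter_comm]
  exact Nat.mul_le_mul_left _ (h1.trans ((Nat.pow_le_pow_right (by omega) hPS).trans h2))

theorem primesLE_succ_of_prime {y : ℕ} (h : (y + 1).Prime) :
    Nat.primesLE (y + 1) = insert (y + 1) (Nat.primesLE y) := by
  ext p
  simp only [Nat.mem_primesLE, Finset.mem_insert]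
  constructor
  · rintro ⟨h1, h2⟩
    by_cases hp : p = y + 1
    · exact Or.inl hp
    · exact Or.inr ⟨by omega, h2⟩
  · rintro (rfl | ⟨h1, h2⟩)
    · exact ⟨le_rfl, h⟩
    · exact ⟨by omega, h2⟩

/-- Every integer `n ≥ 2` lies between two consecutive values of the primorial. -/
theorem exists_primorial_le_lt {n : ℕ} (hn : 2 ≤ n) :
    ∃ y, 2 ≤ y ∧ (y + 1).Prime ∧ primorial y ≤ n ∧ n < (y + 1) * primorial y := by
  have hex : ∃ z, n < primorial z := ⟨n + 1, (Nat.lt_succ_self n).trans_le le_primorial_self⟩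
  classical
  have hz := Nat.find_spec hex
  have hmin : ∀ m, m < Nat.find hex → primorial m ≤ n := fun m hm => not_lt.1 (Nat.find_min hex hm)
  generalize Nat.find hex = z at hz hmin
  have hz3 : 3 ≤ z := by
    by_contra! h
    have h2 : primorial z ≤ primorial 2 := primorial_mono (by omega)
    rw [primorial_two] at h2
    omega
  obtain ⟨y, rfl⟩ : ∃ y, z = y + 1 := ⟨z - 1, by omega⟩
  have hy := hmin y (Nat.lt_succ_self y)
  -- The primorial jumps only at primes.
  have hprime : (y + 1).Prime := by
    by_contra h
    have : primorial (y + 1) = primorial y := by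
      rw [primorial_eq_prod_primesLE, primorial_eq_prod_primesLE]
      congr 1
      ext p
      simp only [Nat.mem_primesLE]
      constructor
      · rintro ⟨h1, h2⟩
        refine ⟨?_, h2⟩
        have : p ≠ y + 1 := by rintro rfl; exact h h2
        omega
      · rintro ⟨h1, h2⟩
        exact ⟨by omega, h2⟩
    omega
  refine ⟨y, by omega, hprime, hy, ?_⟩
  rwa [primorial_eq_prod_primesLE, primesLE_succ_of_prime hprime, Finset.prod_insert (by
    simp [Nat.mem_primesLE]), ← primorial_eq_prod_primesLE] at hz

theorem primesLE_mem_faces {n y : ℕ} (h : primorial y ≤ n) :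
    Nat.primesLE y ∈ (primeComplex n).faces :=
  mem_primeComplex_faces.2 ⟨fun _ => Nat.prime_of_mem_primesLE, h⟩

/-- A face with more than `π(y)` primes would have product at least the primorial of `y + 1`, which
exceeds `n`. -/
theorem primeDim_add_one {n y : ℕ} (hy : 2 ≤ y) (hp : (y + 1).Prime) (h1 : primorial y ≤ n)
    (h2 : n < (y + 1) * primorial y) : primeDim n + 1 = (Nat.primesLE y).card := by
  have hsup : (primeComplex n).faces.sup Finset.card = (Nat.primesLE y).card := by
    refine le_antisymm (Finset.sup_le fun σ hσ => ?_)
      (Finset.le_sup (f := Finset.card) (primesLE_mem_faces h1))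
    rw [mem_primeComplex_faces] at hσ
    by_contra! hlt
    have hmem : y + 1 ∉ Nat.primesLE y := by simp [Nat.mem_primesLE]
    have := primorial_le_prod (z := y + 1) hσ.1 (by
      rw [primesLE_succ_of_prime hp, Finset.card_insert_of_notMem hmem]
      omega)
    rw [primorial_eq_prod_primesLE, primesLE_succ_of_prime hp, Finset.prod_insert hmem,
      ← primorial_eq_prod_primesLE] at this
    omega
  have hpos : 0 < (Nat.primesLE y).card :=
    Finset.card_pos.2 ⟨2, Nat.mem_primesLE.2 ⟨hy, Nat.prime_two⟩⟩
  rw [primeDim, FinComplex.dim, hsup]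
  omega

/-! ### Upper bound for the number of top simplices -/

/-- A set of primes with product at most `n` is counted with weight at least one by the product
of `(y / p) ^ 2`, up to normalization. -/
theorem card_faces_le {n y : ℕ} (hy : 2 ≤ y) (hyn : y ≤ n) :
    (((primeComplex n).faces.filter fun σ => σ.card = (Nat.primesLE y).card).card : ℝ) ≤
      (n / primorial y : ℝ) ^ 2 * 2 ^ (Nat.primesLE y).card *
        ∏ p ∈ Nat.primesLE n \ Nat.primesLE y, (1 + (y / p : ℝ) ^ 2) := by
  set r := (Nat.primesLE y).card with hr
  have hy0 : (0 : ℝ) < y := by exact_mod_cast (by omega : 0 < y)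
  have hP0 : (0 : ℝ) < primorial y := by exact_mod_cast primorial_pos y
  -- Rankin's trick with exponent 2: `(n / ∏ p) ^ 2 ≥ 1`. The powers of `y` cancel since `σ` has
  -- exactly `r` elements.
  have hweight : ∀ σ ∈ (primeComplex n).faces.filter fun σ => σ.card = r,
      (1 : ℝ) ≤ (n / y ^ r : ℝ) ^ 2 * ∏ p ∈ σ, (y / p : ℝ) ^ 2 := by
    intro σ hσ
    rw [Finset.mem_filter, mem_primeComplex_faces] at hσ
    obtain ⟨⟨hp, hn⟩, hc⟩ := hσ
    have hpos : (0 : ℝ) < ∏ p ∈ σ, (p : ℝ) :=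
      Finset.prod_pos fun p h => by exact_mod_cast (hp p h).pos
    have hle : ∏ p ∈ σ, (p : ℝ) ≤ n := by
      rw [← Nat.cast_prod]
      exact_mod_cast hn
    have hyr : (y : ℝ) ^ r ≠ 0 := by positivity
    rw [Finset.prod_pow, Finset.prod_div_distrib, Finset.prod_const, hc, ← mul_pow,
      div_mul_div_cancel₀ hyr]
    exact one_le_pow₀ ((one_le_div hpos).2 hle)
  have hsub : ((primeComplex n).faces.filter fun σ => σ.card = r) ⊆
      (Nat.primesLE n).powerset := by
    intro σ hσ
    rw [Finset.mem_filter, mem_primeComplex_faces] at hσ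
    rw [Finset.mem_powerset]
    intro p hp
    exact Nat.mem_primesLE.2 ⟨(Finset.single_le_prod' (f := fun p => p)
      (fun q hq => (hσ.1.1 q hq).one_le) hp).trans hσ.1.2, hσ.1.1 p hp⟩
  have hsmall : ∏ p ∈ Nat.primesLE y, (1 + (y / p : ℝ) ^ 2) ≤
      2 ^ r * (y ^ r / primorial y : ℝ) ^ 2 := by
    calc ∏ p ∈ Nat.primesLE y, (1 + (y / p : ℝ) ^ 2)
        ≤ ∏ p ∈ Nat.primesLE y, (2 * (y / p : ℝ) ^ 2) := by
          refine Finset.prod_le_prod (fun p _ => by positivity) fun p hp => ?_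
          rw [Nat.mem_primesLE] at hp
          have h0 : (0 : ℝ) < p := by exact_mod_cast hp.2.pos
          have h1 : (1 : ℝ) ≤ y / p := (one_le_div h0).2 (by exact_mod_cast hp.1)
          have h2 := one_le_pow₀ h1 (n := 2)
          linarith
      _ = _ := by
          rw [Finset.prod_mul_distrib, Finset.prod_pow, Finset.prod_div_distrib,
            Finset.prod_const, Finset.prod_const, primorial_eq_prod_primesLE, Nat.cast_prod]
  have hall : ∏ p ∈ Nat.primesLE n, (1 + (y / p : ℝ) ^ 2) =
      (∏ p ∈ Nat.primesLE y, (1 + (y / p : ℝ) ^ 2)) *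
        ∏ p ∈ Nat.primesLE n \ Nat.primesLE y, (1 + (y / p : ℝ) ^ 2) := by
    rw [mul_comm]
    refine (Finset.prod_sdiff fun p hp => ?_).symm
    rw [Nat.mem_primesLE] at hp ⊢
    exact ⟨hp.1.trans hyn, hp.2⟩
  calc (((primeComplex n).faces.filter fun σ => σ.card = r).card : ℝ)
      = ∑ σ ∈ (primeComplex n).faces.filter fun σ => σ.card = r, (1 : ℝ) := by simp
    _ ≤ ∑ σ ∈ (primeComplex n).faces.filter fun σ => σ.card = r,
          (n / y ^ r : ℝ) ^ 2 * ∏ p ∈ σ, (y / p : ℝ) ^ 2 := Finset.sum_le_sum hweight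
    -- Dropping the conditions on size and product turns the sum into an Euler-type product.
    _ ≤ ∑ σ ∈ (Nat.primesLE n).powerset, (n / y ^ r : ℝ) ^ 2 * ∏ p ∈ σ, (y / p : ℝ) ^ 2 :=
        Finset.sum_le_sum_of_subset_of_nonneg hsub fun σ _ _ => by positivity
    _ = (n / y ^ r : ℝ) ^ 2 * ∏ p ∈ Nat.primesLE n, (1 + (y / p : ℝ) ^ 2) := by
        rw [← Finset.mul_sum, Finset.prod_one_add]
    _ ≤ (n / y ^ r : ℝ) ^ 2 * (2 ^ r * (y ^ r / primorial y : ℝ) ^ 2 *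
          ∏ p ∈ Nat.primesLE n \ Nat.primesLE y, (1 + (y / p : ℝ) ^ 2)) := by
        rw [hall]
        gcongr
    _ = _ := by
        field_simp

/-- Partial summation with Chebyshev's bound for `θ`. -/
theorem sum_log_div_sq_le {y : ℕ} (hy : 0 < y) (N : ℕ) :
    ∑ p ∈ Nat.primesLE N \ Nat.primesLE y, Real.log p / (p : ℝ) ^ 2 ≤ 2 * Real.log 4 / y := by
  have hl : 0 < Real.log 4 := Real.log_pos (by norm_num)
  have hy' : (0 : ℝ) < y := by exact_mod_cast hy
  -- The boundary term of Abel summation is kept, so that a new prime's contribution is matched by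
  -- the jump of `θ`; the rest telescopes.
  have key : ∀ k : ℕ, ∑ p ∈ Nat.primesLE (y + k) \ Nat.primesLE y, Real.log p / (p : ℝ) ^ 2 ≤
      Chebyshev.theta (y + k : ℕ) / ((y + k : ℕ) : ℝ) ^ 2 +
        2 * Real.log 4 * (1 / y - 1 / ((y + k : ℕ) : ℝ)) := by
    intro k
    induction k with
    | zero =>
      simp only [add_zero, sdiff_self, Finset.bot_eq_empty, Finset.sum_empty, sub_self, mul_zero]
      exact div_nonneg (Chebyshev.theta_nonneg _) (by positivity)
    | succ k ih =>
      set m := y + k with hm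
      have hm0 : (0 : ℝ) < m := by exact_mod_cast (by omega : 0 < m)
      have hth : Chebyshev.theta (m : ℕ) ≤ Real.log 4 * m := Chebyshev.theta_le_log4_mul_x hm0.le
      rw [show y + (k + 1) = m + 1 by omega]
      have htail : Chebyshev.theta (m : ℕ) * (1 / (m : ℝ) ^ 2 - 1 / ((m : ℝ) + 1) ^ 2) ≤
          2 * Real.log 4 * (1 / m - 1 / ((m : ℝ) + 1)) := by
        have h1 : 0 ≤ 1 / (m : ℝ) ^ 2 - 1 / ((m : ℝ) + 1) ^ 2 := by
          rw [sub_nonneg]; gcongr; linarith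
        refine (mul_le_mul_of_nonneg_right hth h1).trans ?_
        have h2 : 2 * Real.log 4 * (1 / m - 1 / ((m : ℝ) + 1)) -
            Real.log 4 * m * (1 / (m : ℝ) ^ 2 - 1 / ((m : ℝ) + 1) ^ 2) =
              Real.log 4 / (m * ((m : ℝ) + 1) ^ 2) := by
          field_simp
          ring
        have h3 : 0 ≤ Real.log 4 / (m * ((m : ℝ) + 1) ^ 2) := by positivity
        linarith
      by_cases hp : (m + 1).Prime
      · have hn : m + 1 ∉ Nat.primesLE m := by simp [Nat.mem_primesLE]
        have hn' : m + 1 ∉ Nat.primesLE y := by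
          rw [Nat.mem_primesLE]; omega
        have hθ : Chebyshev.theta (m + 1 : ℕ) =
            Real.log ((m + 1 : ℕ) : ℝ) + Chebyshev.theta (m : ℕ) := by
          rw [Chebyshev.theta_eq_sum_primesLE_log, Chebyshev.theta_eq_sum_primesLE_log,
            primesLE_succ_of_prime hp, Finset.sum_insert hn]
        rw [hθ, primesLE_succ_of_prime hp, Finset.insert_sdiff_of_notMem _ hn',
          Finset.sum_insert (fun h => hn (Finset.mem_sdiff.1 h).1), add_div]
        push_cast at *
        have h4 : Chebyshev.theta m * (1 / (m : ℝ) ^ 2 - 1 / ((m : ℝ) + 1) ^ 2) =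
          Chebyshev.theta m / (m : ℝ) ^ 2 - Chebyshev.theta m / ((m : ℝ) + 1) ^ 2 := by ring
        linarith
      · have hP : Nat.primesLE (m + 1) = Nat.primesLE m := by
          ext p
          simp only [Nat.mem_primesLE]
          constructor
          · rintro ⟨h1, h2⟩
            have : p ≠ m + 1 := by rintro rfl; exact hp h2
            exact ⟨by omega, h2⟩
          · rintro ⟨h1, h2⟩
            exact ⟨by omega, h2⟩
        have hθ : Chebyshev.theta (m + 1 : ℕ) = Chebyshev.theta (m : ℕ) := by
          rw [Chebyshev.theta_eq_sum_primesLE_log, Chebyshev.theta_eq_sum_primesLE_log, hP]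
        rw [hP, hθ]
        push_cast at *
        have h4 : Chebyshev.theta m * (1 / (m : ℝ) ^ 2 - 1 / ((m : ℝ) + 1) ^ 2) =
          Chebyshev.theta m / (m : ℝ) ^ 2 - Chebyshev.theta m / ((m : ℝ) + 1) ^ 2 := by ring
        linarith
  rcases le_total N y with h | h
  · have : Nat.primesLE N \ Nat.primesLE y = ∅ := by
      rw [Finset.sdiff_eq_empty_iff_subset]
      intro p hp
      rw [Nat.mem_primesLE] at hp ⊢
      exact ⟨hp.1.trans h, hp.2⟩
    rw [this, Finset.sum_empty]
    positivity
  · obtain ⟨k, rfl⟩ := Nat.exists_eq_add_of_le h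
    refine (key k).trans ?_
    have hm0 : (0 : ℝ) < ((y + k : ℕ) : ℝ) := by exact_mod_cast (by omega : 0 < y + k)
    have hth : Chebyshev.theta ((y + k : ℕ) : ℝ) ≤ Real.log 4 * ((y + k : ℕ) : ℝ) :=
      Chebyshev.theta_le_log4_mul_x hm0.le
    have h1 : Chebyshev.theta ((y + k : ℕ) : ℝ) / ((y + k : ℕ) : ℝ) ^ 2 ≤
        Real.log 4 / ((y + k : ℕ) : ℝ) := by
      rw [div_le_div_iff₀ (by positivity) hm0]
      calc _ ≤ Real.log 4 * ((y + k : ℕ) : ℝ) * ((y + k : ℕ) : ℝ) := by gcongr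
        _ = _ := by ring
    have h2 : 2 * Real.log 4 * (1 / y - 1 / ((y + k : ℕ) : ℝ)) =
      2 * Real.log 4 / y - 2 * (Real.log 4 / ((y + k : ℕ) : ℝ)) := by ring
    have h3 : 0 ≤ Real.log 4 / ((y + k : ℕ) : ℝ) := by positivity
    linarith

/-- Use `1 + t ≤ exp t` and insert `log p / log y ≥ 1`, which gains the factor `1 / log y` over the
trivial bound. -/
theorem prod_one_add_div_sq_le {y : ℕ} (hy : 2 ≤ y) (N : ℕ) :
    ∏ p ∈ Nat.primesLE N \ Nat.primesLE y, (1 + (y / p : ℝ) ^ 2) ≤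
      Real.exp (2 * Real.log 4 * (y / Real.log y)) := by
  have hy0 : (0 : ℝ) < y := by exact_mod_cast (by omega : 0 < y)
  have hly : 0 < Real.log y := Real.log_pos (by exact_mod_cast (by omega : 1 < y))
  calc ∏ p ∈ Nat.primesLE N \ Nat.primesLE y, (1 + (y / p : ℝ) ^ 2)
      ≤ ∏ p ∈ Nat.primesLE N \ Nat.primesLE y,
          Real.exp (y ^ 2 / Real.log y * (Real.log p / (p : ℝ) ^ 2)) := by
        refine Finset.prod_le_prod (fun p _ => by positivity) fun p hp => ?_
        rw [Finset.mem_sdiff, Nat.mem_primesLE, Nat.mem_primesLE] at hp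
        have hyp : (y : ℝ) ≤ p := by
          have : y < p := by
            by_contra! h
            exact hp.2 ⟨h, hp.1.2⟩
          exact_mod_cast this.le
        have hlog : 1 ≤ Real.log p / Real.log y :=
          (one_le_div hly).2 (Real.log_le_log hy0 hyp)
        calc 1 + (y / p : ℝ) ^ 2 ≤ Real.exp ((y / p : ℝ) ^ 2) := by
              rw [add_comm]; exact Real.add_one_le_exp _
          _ ≤ _ := by
              rw [Real.exp_le_exp]
              calc (y / p : ℝ) ^ 2 = (y / p : ℝ) ^ 2 * 1 := (mul_one _).symm
                _ ≤ (y / p : ℝ) ^ 2 * (Real.log p / Real.log y) := by gcongr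
                _ = _ := by ring
    _ = Real.exp (y ^ 2 / Real.log y *
          ∑ p ∈ Nat.primesLE N \ Nat.primesLE y, Real.log p / (p : ℝ) ^ 2) := by
        rw [← Real.exp_sum, Finset.mul_sum]
    _ ≤ _ := by
        rw [Real.exp_le_exp]
        calc _ ≤ (y : ℝ) ^ 2 / Real.log y * (2 * Real.log 4 / y) := by
              gcongr
              exact sum_log_div_sq_le (by omega) N
          _ = _ := by field_simp

/-- Rankin's factor `n / primorial y` is at most `y + 1`, so it costs only a power of `y`. -/
theorem numSimplices_primeDim_le {n y : ℕ} (hy : 2 ≤ y) (hp : (y + 1).Prime)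
    (h1 : primorial y ≤ n) (h2 : n < (y + 1) * primorial y) :
    ((primeComplex n).numSimplices (primeDim n) : ℝ) ≤
      (y + 1 : ℝ) ^ 2 * 2 ^ (primeDim n + 1) * Real.exp (2 * Real.log 4 * (y / Real.log y)) := by
  have hP0 : (0 : ℝ) < primorial y := by exact_mod_cast primorial_pos y
  rw [FinComplex.numSimplices, primeDim_add_one hy hp h1 h2]
  refine (card_faces_le hy (le_primorial_self.trans h1)).trans ?_
  have h3 : (n : ℝ) / primorial y ≤ y + 1 := by
    rw [div_le_iff₀ hP0]
    exact_mod_cast h2.le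
  have := prod_one_add_div_sq_le hy n
  gcongr

theorem numSimplices_primeDim_pos {n y : ℕ} (hy : 2 ≤ y) (hp : (y + 1).Prime)
    (h1 : primorial y ≤ n) (h2 : n < (y + 1) * primorial y) :
    0 < (primeComplex n).numSimplices (primeDim n) := by
  rw [FinComplex.numSimplices, primeDim_add_one hy hp h1 h2, Finset.card_pos]
  exact ⟨_, Finset.mem_filter.2 ⟨primesLE_mem_faces h1, rfl⟩⟩

/-! ### Asymptotics in `y` -/

theorem eventually_log_add_one_le {ε : ℝ} (hε : 0 < ε) :
    ∀ᶠ y : ℕ in atTop, Real.log ((y : ℝ) + 1) ≤ ε * (y + 1) := by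
  have h := (Real.isLittleO_log_id_atTop.bound hε)
  have ht : Tendsto (fun y : ℕ => (y : ℝ) + 1) atTop atTop :=
    tendsto_atTop_add_const_right _ 1 tendsto_natCast_atTop_atTop
  filter_upwards [ht.eventually h] with y hy
  rw [Real.norm_eq_abs, id, Real.norm_of_nonneg (by positivity)] at hy
  exact (le_abs_self _).trans hy

theorem eventually_log_le_sqrt {ε : ℝ} (hε : 0 < ε) :
    ∀ᶠ y : ℕ in atTop, Real.log y ≤ ε * Real.sqrt y := by
  have h := ((isLittleO_log_rpow_atTop (r := 1 / 2) (by norm_num)).bound hε)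
  filter_upwards [tendsto_natCast_atTop_atTop.eventually h] with y hy
  rw [← Real.sqrt_eq_rpow, Real.norm_eq_abs, Real.norm_of_nonneg (by positivity)] at hy
  exact (le_abs_self _).trans hy

theorem exists_pos_mul_le_theta : ∃ c : ℝ, 0 < c ∧ ∀ᶠ y : ℕ in atTop, c * y ≤ Chebyshev.theta y := by
  have hl2 : (1 / 2 : ℝ) < Real.log 2 := by linarith [Real.log_two_gt_d9]
  refine ⟨1 / 4, by norm_num, ?_⟩
  filter_upwards [eventually_log_add_one_le (ε := 1 / 32) (by norm_num),
    eventually_log_le_sqrt (ε := 1 / 32) (by norm_num), eventually_ge_atTop 1] with y h3 h4 hy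
  have hy0 : (1 : ℝ) ≤ y := by exact_mod_cast hy
  have h5 := Chebyshev.theta_ge y
  have h6 : 2 * Real.sqrt y * Real.log y ≤ 2 * (1 / 32) * y := by
    have := Real.mul_self_sqrt (by linarith : (0 : ℝ) ≤ y)
    calc 2 * Real.sqrt y * Real.log y ≤ 2 * Real.sqrt y * (1 / 32 * Real.sqrt y) := by gcongr
      _ = 2 * (1 / 32) * (Real.sqrt y * Real.sqrt y) := by ring
      _ = _ := by rw [this]
  have h7 : (y : ℝ) * (1 / 2) ≤ y * Real.log 2 := by gcongr
  linarith

/-- The leading term must be `θ(y)` itself, with constant 1, for it to cancel against the logarithm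
of the primorial; a bound of the form `O(y)` would not suffice. -/
theorem exists_primeCounting_mul_log_le : ∃ C : ℝ, ∀ᶠ y : ℕ in atTop,
    ((Nat.primesLE y).card : ℝ) * Real.log y ≤ Chebyshev.theta y + C * (y / Real.log y) := by
  obtain ⟨C, hC⟩ := Chebyshev.primeCounting_sub_theta_div_log_isBigO.bound
  refine ⟨C, ?_⟩
  filter_upwards [tendsto_natCast_atTop_atTop.eventually hC, eventually_ge_atTop 2] with y h hy
  have hly : 0 < Real.log y := Real.log_pos (by exact_mod_cast (by omega : 1 < y))
  rw [Nat.floor_natCast, ← Nat.primesLE_card_eq_primeCounting, Real.norm_eq_abs, Real.norm_eq_abs,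
    abs_of_nonneg (a := (y : ℝ) / Real.log y ^ 2) (by positivity)] at h
  have h1 := mul_le_mul_of_nonneg_right ((le_abs_self _).trans h) hly.le
  have h2 : ((Nat.primesLE y).card - Chebyshev.theta y / Real.log y) * Real.log y =
      (Nat.primesLE y).card * Real.log y - Chebyshev.theta y := by field_simp
  have h3 : C * (y / Real.log y ^ 2) * Real.log y = C * (y / Real.log y) := by field_simp
  linarith

theorem tendsto_log_log_natCast :
    Tendsto (fun y : ℕ => Real.log (Real.log y)) atTop atTop :=
  Real.tendsto_log_atTop.comp (Real.tendsto_log_atTop.comp tendsto_natCast_atTop_atTop)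

/-- The number of orderings of the primes up to `y`, even after multiplication by an exponential
in the number of these primes, is much smaller than their product. -/
theorem exists_factorial_mul_le_primorial (K : ℝ) : ∃ c : ℝ, 0 < c ∧ ∀ᶠ y : ℕ in atTop,
    ((Nat.primesLE y).card ! : ℝ) * 8 ^ (Nat.primesLE y).card * (y + 1) ^ 2 *
      Real.exp (K * (y / Real.log y)) ≤
      primorial y * Real.exp (-c * (y / Real.log y * Real.log (Real.log y))) := by
  obtain ⟨c, hc, hθ⟩ := exists_pos_mul_le_theta
  obtain ⟨C, hC⟩ := exists_primeCounting_mul_log_le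
  set D : ℝ := Real.log 4 + max C 0 with hD
  have hl4 : 0 < Real.log 4 := Real.log_pos (by norm_num)
  have hD0 : 0 < D := by positivity
  -- Collects all losses of order `q = y / log y`; the 1 pays for `(y + 1) ^ 2`. Half of the saving
  -- `c q log log y` covers `K' q` once `log log y ≥ 2 K' / c`, and the other half remains.
  set K' : ℝ := C + D * |Real.log D| + D * Real.log 8 + 1 + K with hK'
  refine ⟨c / 2, by positivity, ?_⟩
  have hsmall : ∀ᶠ y : ℕ in atTop, 2 * Real.log ((y : ℝ) + 1) ≤ y / Real.log y := by
    filter_upwards [eventually_log_le_sqrt (ε := 1 / 2) (by norm_num), eventually_ge_atTop 2]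
      with y h2 hy
    have hy0 : (2 : ℝ) ≤ y := by exact_mod_cast hy
    have hly : 0 < Real.log y := Real.log_pos (by linarith)
    rw [le_div_iff₀ hly]
    have h3 : Real.log ((y : ℝ) + 1) ≤ 2 * Real.log y := by
      rw [← Real.log_rpow (by linarith)]
      refine Real.log_le_log (by linarith) ?_
      norm_num
      nlinarith
    have := Real.mul_self_sqrt (by linarith : (0 : ℝ) ≤ y)
    calc 2 * Real.log ((y : ℝ) + 1) * Real.log y ≤ 2 * (2 * Real.log y) * Real.log y := by gcongr
      _ = 4 * (Real.log y * Real.log y) := by ring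
      _ ≤ 4 * ((1 / 2 * Real.sqrt y) * (1 / 2 * Real.sqrt y)) := by gcongr
      _ = Real.sqrt y * Real.sqrt y := by ring
      _ = y := this
  filter_upwards [hθ, hC, hsmall, eventually_ge_atTop 3,
    tendsto_log_log_natCast.eventually_ge_atTop (2 * K' / c),
    tendsto_log_log_natCast.eventually_ge_atTop 0] with y h1 h2 h3 hy h4 h5
  have hy0 : (0 : ℝ) < y := by exact_mod_cast (by omega : 0 < y)
  have hly : 0 < Real.log y := Real.log_pos (by exact_mod_cast (by omega : 1 < y))
  set r := (Nat.primesLE y).card with hr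
  have hr0 : (0 : ℝ) < r := by
    exact_mod_cast Finset.card_pos.2 ⟨2, Nat.mem_primesLE.2 ⟨by omega, Nat.prime_two⟩⟩
  set q : ℝ := y / Real.log y with hq
  have hq0 : 0 < q := by positivity
  have hqy : q * Real.log y = y := by rw [hq]; field_simp
  have hrlow : c * q ≤ r := by
    have h6 := Chebyshev.theta_le_pi_mul_log y
    rw [← Nat.primesLE_card_eq_primeCounting] at h6
    have : c * q * Real.log y ≤ r * Real.log y := by
      rw [mul_assoc, hqy]
      exact h1.trans h6
    exact le_of_mul_le_mul_right this hly
  have hly1 : 1 ≤ Real.log y := by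
    have := Real.exp_le_exp.2 h5
    rwa [Real.exp_log hly, Real.exp_zero] at this
  have hrup : (r : ℝ) ≤ D * q := by
    have h6 : Chebyshev.theta y ≤ Real.log 4 * y := Chebyshev.theta_le_log4_mul_x hy0.le
    have h7 : C * q ≤ max C 0 * y := by
      have h8 : q ≤ y := by rw [hq]; exact div_le_self hy0.le hly1
      calc C * q ≤ max C 0 * q := by gcongr; exact le_max_left _ _
        _ ≤ max C 0 * y := by gcongr
    have : r * Real.log y ≤ D * q * Real.log y := by
      rw [mul_assoc, hqy, hD, add_mul]
      linarith
    exact le_of_mul_le_mul_right this hly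
  -- The term `-log log y` is the source of the final saving.
  have hlogr : Real.log r ≤ |Real.log D| + Real.log y - Real.log (Real.log y) := by
    have h6 := Real.log_le_log hr0 hrup
    rw [Real.log_mul hD0.ne' hq0.ne', hq, Real.log_div hy0.ne' hly.ne'] at h6
    linarith [le_abs_self (Real.log D)]
  have hfact : ((r !  : ℕ) : ℝ) ≤ Real.exp (r * Real.log r) := by
    rw [mul_comm, ← Real.rpow_def_of_pos hr0, Real.rpow_natCast]
    exact_mod_cast Nat.factorial_le_pow r
  have hprim : (primorial y : ℝ) = Real.exp (Chebyshev.theta y) := by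
    rw [Chebyshev.theta_eq_log_primorial, Nat.floor_natCast,
      Real.exp_log (by exact_mod_cast primorial_pos y)]
  have h8 : (8 : ℝ) ^ r = Real.exp (r * Real.log 8) := by
    rw [mul_comm, ← Real.rpow_def_of_pos (by norm_num), Real.rpow_natCast]
  have hy2 : ((y : ℝ) + 1) ^ 2 = Real.exp (2 * Real.log ((y : ℝ) + 1)) := by
    rw [mul_comm, ← Real.rpow_def_of_pos (by linarith)]
    norm_num
  rw [hprim, h8, hy2, ← Real.exp_add]
  calc _ ≤ Real.exp (r * Real.log r) * Real.exp (r * Real.log 8) *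
        Real.exp (2 * Real.log ((y : ℝ) + 1)) * Real.exp (K * q) := by gcongr
    _ = Real.exp (r * Real.log r + r * Real.log 8 + 2 * Real.log ((y : ℝ) + 1) + K * q) := by
      rw [Real.exp_add, Real.exp_add, Real.exp_add]
    _ ≤ _ := by
      rw [Real.exp_le_exp]
      have e1 : r * Real.log r ≤
          r * |Real.log D| + r * Real.log y - r * Real.log (Real.log y) := by
        calc r * Real.log r ≤ r * (|Real.log D| + Real.log y - Real.log (Real.log y)) := by gcongr
          _ = _ := by ring
      have e2 : r * |Real.log D| ≤ D * q * |Real.log D| := by gcongr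
      have e3 : r * Real.log 8 ≤ D * q * Real.log 8 := by
        have : 0 ≤ Real.log 8 := Real.log_nonneg (by norm_num)
        gcongr
      have e4 : c * q * Real.log (Real.log y) ≤ r * Real.log (Real.log y) := by gcongr
      have e5 : K' * q ≤ c / 2 * Real.log (Real.log y) * q := by
        rw [div_le_iff₀ hc] at h4
        gcongr
        linarith
      have e6 : K' * q = C * q + D * q * |Real.log D| + D * q * Real.log 8 + q + K * q := by
        rw [hK']; ring
      have e7 : -(c / 2) * (q * Real.log (Real.log y)) =
        c / 2 * Real.log (Real.log y) * q - c * q * Real.log (Real.log y) := by ring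
      linarith

/-- Crude bounds suffice: `√y ≤ log n ≤ 2 y` gives `log y / 2 ≤ log log n ≤ (log y) ^ 2`. Numerator
and denominator are then bounded separately, each of three estimates costing a factor 2. -/
theorem eventually_log_mul_le : ∀ᶠ y : ℕ in atTop, ∀ n : ℕ, primorial y ≤ n →
    n < (y + 1) * primorial y →
    Real.log n * Real.log (Real.log (Real.log n)) / Real.log (Real.log n) ≤
      8 * (y / Real.log y * Real.log (Real.log y)) := by
  obtain ⟨c, hc, hθ⟩ := exists_pos_mul_le_theta
  have hlog : ∀ᶠ y : ℕ in atTop, Real.log ((y : ℝ) + 1) ≤ 1 / 2 * y := by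
    filter_upwards [eventually_log_add_one_le (ε := 1 / 4) (by norm_num), eventually_ge_atTop 1]
      with y h2 hy
    have hy0 : (1 : ℝ) ≤ y := by exact_mod_cast hy
    linarith
  have hsqrt : ∀ᶠ y : ℕ in atTop, Real.sqrt y ≤ c * y := by
    have h1 : Tendsto (fun y : ℕ => Real.sqrt y) atTop atTop :=
      Real.tendsto_sqrt_atTop.comp tendsto_natCast_atTop_atTop
    filter_upwards [h1.eventually_ge_atTop (1 / c)] with y h2
    rw [div_le_iff₀ hc] at h2
    calc Real.sqrt y = 1 * Real.sqrt y := (one_mul _).symm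
      _ ≤ Real.sqrt y * c * Real.sqrt y := by gcongr
      _ = c * (Real.sqrt y * Real.sqrt y) := by ring
      _ = c * y := by rw [Real.mul_self_sqrt (by positivity)]
  filter_upwards [hθ, hlog, hsqrt, tendsto_log_log_natCast.eventually_ge_atTop 1,
    eventually_ge_atTop 3] with y h1 h2 h3 h4 hy n hn1 hn2
  have hy0 : (3 : ℝ) ≤ y := by exact_mod_cast hy
  have hly : 0 < Real.log y := Real.log_pos (by linarith)
  have hL2 : 2 ≤ Real.log y := by
    have h5 := Real.exp_le_exp.2 h4
    rw [Real.exp_log hly] at h5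
    linarith [Real.add_one_le_exp (1 : ℝ)]
  have hP0 : (0 : ℝ) < primorial y := by exact_mod_cast primorial_pos y
  have hθP : Chebyshev.theta y = Real.log (primorial y) := by
    rw [Chebyshev.theta_eq_log_primorial, Nat.floor_natCast]
  have hn1' : (primorial y : ℝ) ≤ n := by exact_mod_cast hn1
  have hn2' : (n : ℝ) ≤ (y + 1) * primorial y := by exact_mod_cast hn2.le
  have hlow : Real.sqrt y ≤ Real.log n := by
    have := Real.log_le_log hP0 hn1'
    linarith
  have hup : Real.log n ≤ 2 * y := by
    have h5 := Real.log_le_log (by linarith) hn2'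
    rw [Real.log_mul (by linarith) hP0.ne', ← hθP] at h5
    have h6 : Chebyshev.theta y ≤ Real.log 4 * y := Chebyshev.theta_le_log4_mul_x (by linarith)
    have h7 : Real.log 4 * y ≤ 3 / 2 * y := by
      have : Real.log 4 ≤ 3 / 2 := by
        rw [show (4 : ℝ) = 2 ^ 2 by norm_num, Real.log_pow]
        push_cast
        linarith [Real.log_two_lt_d9]
      gcongr
    linarith
  have hs0 : 0 < Real.sqrt y := Real.sqrt_pos.2 (by linarith)
  have hln : 0 < Real.log n := hs0.trans_le hlow
  have hlow2 : Real.log y / 2 ≤ Real.log (Real.log n) := by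
    have := Real.log_le_log hs0 hlow
    rwa [Real.log_sqrt (by linarith)] at this
  have hlln : 0 < Real.log (Real.log n) := by linarith
  have hup2 : Real.log (Real.log n) ≤ Real.log y ^ 2 := by
    have h5 := Real.log_le_log hln hup
    rw [Real.log_mul (by norm_num) (by linarith)] at h5
    have h6 : Real.log 2 ≤ Real.log y := Real.log_le_log (by norm_num) (by linarith)
    nlinarith
  have hup3 : Real.log (Real.log (Real.log n)) ≤ 2 * Real.log (Real.log y) := by
    have h5 := Real.log_le_log hlln hup2
    rw [Real.log_pow] at h5
    exact_mod_cast h5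
  rw [div_le_iff₀ hlln]
  calc Real.log n * Real.log (Real.log (Real.log n))
      ≤ Real.log n * (2 * Real.log (Real.log y)) := by gcongr
    _ ≤ 2 * y * (2 * Real.log (Real.log y)) := by gcongr
    _ = 8 * (y / Real.log y * Real.log (Real.log y)) * (Real.log y / 2) := by
      field_simp
      norm_num
    _ ≤ _ := by gcongr

theorem exists_factorial_mul_le (K : ℝ) : ∃ A : ℝ, 0 < A ∧ ∀ᶠ y : ℕ in atTop, ∀ n : ℕ,
    primorial y ≤ n → n < (y + 1) * primorial y →
    ((Nat.primesLE y).card ! : ℝ) * 8 ^ (Nat.primesLE y).card * (y + 1) ^ 2 *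
      Real.exp (K * (y / Real.log y)) ≤
      n * Real.exp (-A * (Real.log n * Real.log (Real.log (Real.log n)) /
            Real.log (Real.log n))) := by
  obtain ⟨c, hc, h⟩ := exists_factorial_mul_le_primorial K
  refine ⟨c / 8, by positivity, ?_⟩
  filter_upwards [h, eventually_log_mul_le] with y h1 h2 n hn1 hn2
  refine h1.trans (mul_le_mul (by exact_mod_cast hn1) (Real.exp_le_exp.2 ?_)
    (Real.exp_pos _).le (Nat.cast_nonneg n))
  have h3 := mul_le_mul_of_nonneg_left (h2 n hn1 hn2) (by positivity : 0 ≤ c / 8)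
  linarith

/-! ### Conclusion -/

theorem abs_eulerChar_le {n y : ℕ} {C : ℝ} (hy : 2 ≤ y) (hp : (y + 1).Prime)
    (h1 : primorial y ≤ n) (h2 : n < (y + 1) * primorial y)
    (hα : |(alpha n : ℝ)| ≤ C * ((primeDim n + 1)! : ℝ) ^ 2) :
    |((primeComplex n).eulerChar : ℝ)| ≤
      C * (((Nat.primesLE y).card ! : ℝ) * 8 ^ (Nat.primesLE y).card * (y + 1) ^ 2 *
        Real.exp (2 * Real.log 4 * (y / Real.log y))) := by
  have hH := hCoeff_one (primeDim n)
  set d := primeDim n with hd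
  have hr : d + 1 = (Nat.primesLE y).card := primeDim_add_one hy hp h1 h2
  have hHpos : (0 : ℝ) < hCoeff 1 d := by
    rw [hH]
    exact_mod_cast eigenCoeff_zero_pos d
  have hHle : (hCoeff 1 d : ℝ) ≤ 2 * 4 ^ d / (d + 1)! := by
    rw [hH]
    simpa using (Rat.cast_le (K := ℝ)).2 (eigenCoeff_zero_le d)
  have hf := numSimplices_primeDim_le hy hp h1 h2
  have hfpos := numSimplices_primeDim_pos hy hp h1 h2
  rw [← hd] at hf hfpos
  set f := (primeComplex n).numSimplices d
  have hfpos' : (0 : ℝ) < f := by exact_mod_cast hfpos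
  have hfac : (0 : ℝ) < (d + 1)! := by exact_mod_cast Nat.factorial_pos _
  have hC : 0 ≤ C := by
    by_contra! hneg
    have : C * ((d + 1)! : ℝ) ^ 2 < 0 := mul_neg_of_neg_of_pos hneg (by positivity)
    linarith [abs_nonneg (alpha n : ℝ)]
  have hχ : ((primeComplex n).eulerChar : ℝ) = alpha n * (hCoeff 1 d * f) := by
    rw [alpha]
    push_cast
    -- Undoing the division requires both `H_{1,d}` and the number of top simplices to be nonzero.
    rw [← hd]
    exact (div_mul_cancel₀ _ (mul_pos hHpos hfpos').ne').symm
  rw [hχ, abs_mul, abs_of_pos (mul_pos hHpos hfpos'), ← hr]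
  calc |(alpha n : ℝ)| * (hCoeff 1 d * f)
      ≤ C * ((d + 1)! : ℝ) ^ 2 * (2 * 4 ^ d / (d + 1)! * ((y + 1 : ℝ) ^ 2 * 2 ^ (d + 1) *
          Real.exp (2 * Real.log 4 * (y / Real.log y)))) := by gcongr
    _ = C * ((d + 1)! * (2 * 4 ^ d * 2 ^ (d + 1)) * (y + 1) ^ 2 *
          Real.exp (2 * Real.log 4 * (y / Real.log y))) := by
        field_simp
    _ ≤ _ := by
        gcongr
        calc (2 : ℝ) * 4 ^ d * 2 ^ (d + 1) ≤ 4 * 4 ^ d * 2 ^ (d + 1) := by gcongr; norm_num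
          _ = 8 ^ (d + 1) := by
            rw [← pow_succ', ← mul_pow]; norm_num

theorem mainTheorem4 :
    (∀ n : ℕ, 1 ≤ n →
      (primeComplex n).eulerChar = -∑ k ∈ Finset.Icc 1 n, ArithmeticFunction.moebius k) ∧
    (((fun n : ℕ => (alpha n : ℝ)) =O[atTop] fun n : ℕ => ((primeDim n + 1)! : ℝ) ^ 2) →
      ∃ A : ℝ, 0 < A ∧
        (fun n : ℕ => ((primeComplex n).eulerChar : ℝ)) =O[atTop] fun n : ℕ =>
          (n : ℝ) * Real.exp (-A * (Real.log n * Real.log (Real.log (Real.log n)) /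
            Real.log (Real.log n)))) := by
  refine ⟨fun n _ => eulerChar_primeComplex n, fun hα => ?_⟩
  obtain ⟨C, hCpos, hC⟩ := hα.exists_pos
  rw [isBigOWith_iff] at hC
  obtain ⟨A, hA, hev⟩ := exists_factorial_mul_le (2 * Real.log 4)
  obtain ⟨Y, hY⟩ := eventually_atTop.1 hev
  refine ⟨A, hA, IsBigO.of_bound C ?_⟩
  filter_upwards [hC, eventually_ge_atTop 2, eventually_ge_atTop ((Y + 1) * primorial Y)]
    with n h1 h2 h3
  obtain ⟨y, hy, hp, hn1, hn2⟩ := exists_primorial_le_lt h2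
  -- The threshold on `n` translates into one on `y`: for `y < Y`, `n` would be below `(Y + 1) *
  -- primorial Y`.
  have hYy : Y ≤ y := by
    by_contra! h
    have : (y + 1) * primorial y ≤ (Y + 1) * primorial Y :=
      Nat.mul_le_mul (by omega) (primorial_mono h.le)
    omega
  rw [Real.norm_eq_abs, Real.norm_of_nonneg (by positivity)] at h1
  rw [Real.norm_eq_abs, Real.norm_of_nonneg (by positivity)]
  exact (abs_eulerChar_le hy hp hn1 hn2 h1).trans
    (mul_le_mul_of_nonneg_left (hY y hYy n hn1 hn2) hCpos.le)
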